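/- A polytope in $\mathbb{R}^d$ is the convex hull of a nonempty finite set of points; its dimension is that of its affine hull. For a polytope $P\subset\mathbb{R}^d$ and a direction $y\in\mathbb{R}^d$ (acting by $x\mapsto \sum_i y_i x_i$) let $P_y$ be the $y$-maximal face of $P$, i.e. the set of points of $P$ at which $y$ attains its maximum over $P$. A face of $P$ is a nonempty intersection of $P$ with the boundary $\{a\cdot x=b\}$ of a halfspace $\{a\cdot x\le b\}$ containing $P$ ($a=0$, $b=0$ is allowed, so $P$ is a face of itself), and a $k$-face is a face of dimension $k$. The normal cone of a face $F$ is $N_P(F)=\{y : P_y\supseteq F\}$, and the normal fan of $P$ is the collection of the normal cones of all faces of $P$. The polytope $P$ is a generalized permutahedron if every cone of its normal fan is a union of cones of the normal fan of the standard permutahedron, the convex hull of all permutations of $(1,2,\dots,d)$. Write $[m]=\{1,\dots,m\}$. Theorem. Let $P\subset\mathbb{R}^d$ be a generalized permutahedron and $k\in\{0,\dots,d-1\}$. For positive integers $m$ let $$\chi_{d,k}(P)(m)=\#\{y\in[m]^d : P_y \text{ is a } k\text{-face}\}.$$ Then there is a polynomial, also denoted $\chi_{d,k}(P)$, that agrees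 with this function at all positive integers $m$; it has degree exactly $d-k$ if $k\le\dim P$, and it is the zero polynomial if $k>\dim P$. Moreover, for every positive integer $m$, $$(-1)^{d-k}\,\chi_{d,k}(P)(-m)=\sum_{y\in[m]^d}\#\{k\text{-faces of } P_y\}.$$ -/

import Mathlib

namespace GenPerm

/-- A (nonempty) polytope in `ℝ^d`: the convex hull of a nonempty finite set of points. -/
def IsPolytope {d : ℕ} (P : Set (Fin d → ℝ)) : Prop :=
  ∃ S : Set (Fin d → ℝ), S.Finite ∧ S.Nonempty ∧ P = convexHull ℝ S

/-- The dimension of a nonempty set: the dimension of its affine hull. -/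
noncomputable def dim {d : ℕ} (Q : Set (Fin d → ℝ)) : ℕ :=
  Module.finrank ℝ (affineSpan ℝ Q).direction

/-- The action of the direction `y` as a linear functional on `ℝ^d`. -/
def pairing {d : ℕ} (y x : Fin d → ℝ) : ℝ := ∑ i, x i * y i

/-- The `y`-maximal face `P_y`. -/
def maxFace {d : ℕ} (P : Set (Fin d → ℝ)) (y : Fin d → ℝ) : Set (Fin d → ℝ) :=
  {x | x ∈ P ∧ ∀ x' ∈ P, pairing y x' ≤ pairing y x}

/-- `F` is a (nonempty) face of `P`: the intersection of `P` with the boundary `a · x = b` of a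
halfspace `a · x ≤ b` that contains `P`; the case `a = 0`, `b = 0` makes `P` a face of itself. -/
def IsFace {d : ℕ} (P F : Set (Fin d → ℝ)) : Prop :=
  F.Nonempty ∧ ∃ (a : Fin d → ℝ) (b : ℝ),
    (∀ x ∈ P, pairing a x ≤ b) ∧ F = {x | x ∈ P ∧ pairing a x = b}

/-- The closed normal cone `N_P(F)`: all directions that are maximized on all of `F`. -/
def normalCone {d : ℕ} (P F : Set (Fin d → ℝ)) : Set (Fin d → ℝ) :=
  {y | F ⊆ maxFace P y}

/-- The normal fan: the collection of the normal cones of all faces. -/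
def normalFan {d : ℕ} (P : Set (Fin d → ℝ)) : Set (Set (Fin d → ℝ)) :=
  {N | ∃ F, IsFace P F ∧ N = normalCone P F}

/-- `𝒩` is a coarsening of `𝒩'`: every cone of `𝒩` is the union of some cones of `𝒩'`. -/
def IsCoarsening {d : ℕ} (𝒩 𝒩' : Set (Set (Fin d → ℝ))) : Prop :=
  ∀ N ∈ 𝒩, ∃ S ⊆ 𝒩', N = ⋃₀ S

/-- The standard permutahedron: the convex hull of the permutations of `(1, 2, …, d)`. -/
def stdPermutahedron (d : ℕ) : Set (Fin d → ℝ) :=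
  convexHull ℝ (Set.range fun σ : Equiv.Perm (Fin d) => fun i => ((σ i : ℕ) : ℝ) + 1)

/-- A generalized permutahedron: a polytope whose normal fan is a coarsening of the normal fan of
the standard permutahedron. -/
def IsGeneralizedPermutahedron {d : ℕ} (P : Set (Fin d → ℝ)) : Prop :=
  IsPolytope P ∧ IsCoarsening (normalFan P) (normalFan (stdPermutahedron d))

/-- The finite set `[m]^d` of integer directions. -/
def box (d m : ℕ) : Finset (Fin d → ℕ) := Fintype.piFinset fun _ => Finset.Icc 1 m

/-- An integer direction as a real one. -/
def toDir {d : ℕ} (y : Fin d → ℕ) : Fin d → ℝ := fun i => (y i : ℝ)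

open Classical in
/-- `χ_{d,k}(P)(m)`: the number of `y ∈ [m]^d` whose `y`-maximal face has dimension `k`. -/
noncomputable def chi {d : ℕ} (k : ℕ) (P : Set (Fin d → ℝ)) (m : ℕ) : ℕ :=
  ((box d m).filter fun y => dim (maxFace P (toDir y)) = k).card

/-- The number of `k`-dimensional faces of a polytope. -/
noncomputable def numFaces {d : ℕ} (k : ℕ) (Q : Set (Fin d → ℝ)) : ℕ :=
  {F | IsFace Q F ∧ dim F = k}.ncard

end GenPerm

/-! By the fan hypothesis, the normal cone of each face F of P consists of the y with y_i ≤ y_j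
whenever `r i j`, for some preorder r on the coordinates (`exists_isNormalPreorder`). Its relative
interior, the strictly compatible y, is the set of directions with P_y = F (`maxFace_eq_iff`). Its
linear span has dimension d - dim F, the number of classes of r (`finrank_add_dim`).

Hence for a single face the numbers of y in [m]^d with P_y = F and with P_y ⊇ F are the strict and
weak order polynomials of r, related by Stanley's reciprocity (`exists_orderPolynomial`). That is
proved by splitting on an incomparable pair until r is total, where the counts are binomial
coefficients.

Summing over the finitely many k-faces gives the theorem, because the faces of P_y are the faces of
P inside P_y (`isFace_maxFace_iff`). All summands have positive coefficient in degree d - k, so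
nothing cancels; `exists_face_dim_eq` supplies a summand for each k ≤ dim P. -/

open Polynomial

/-! ### Preorders and the effect of adding a relation -/

/-- The relation obtained from the preorder `r` by declaring `a` to lie below `b`. -/
def insertRel {α : Type*} (r : α → α → Prop) (a b : α) : α → α → Prop :=
  fun i j => r i j ∨ (r i a ∧ r b j)

/-- `y` is weakly increasing along `r`. -/
def Compat {α β : Type*} [LE β] (r : α → α → Prop) (y : α → β) : Prop :=
  ∀ i j, r i j → y i ≤ y j

/-- `y` is weakly increasing along `r` and strictly increasing along its strict part. -/
def StrictCompat {α β : Type*} [Preorder β] (r : α → α → Prop) (y : α → β) : Prop :=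
  ∀ i j, r i j → y i ≤ y j ∧ (¬ r j i → y i < y j)

/-- A reflexive and transitive relation. -/
structure IsPre {α : Type*} (r : α → α → Prop) : Prop where
  refl : ∀ a, r a a
  trans : ∀ a b c, r a b → r b c → r a c

theorem StrictCompat.compat {α β : Type*} [Preorder β] {r : α → α → Prop} {y : α → β}
    (h : StrictCompat r y) : Compat r y := fun i j hij => (h i j hij).1

theorem IsPre.insertRel {α : Type*} {r : α → α → Prop} (hr : IsPre r) (a b : α) :
    IsPre (insertRel r a b) := by
  have h1 := hr.refl
  have h2 := hr.trans
  constructor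
  · intro i; exact Or.inl (h1 i)
  · rintro i j k (h | ⟨h, h'⟩) (g | ⟨g, g'⟩)
    · exact Or.inl (h2 _ _ _ h g)
    · exact Or.inr ⟨h2 _ _ _ h g, g'⟩
    · exact Or.inr ⟨h, h2 _ _ _ h' g⟩
    · exact Or.inr ⟨h, g'⟩

section Splitting

variable {α β : Type*} {r : α → α → Prop} {a b : α}

theorem compat_insertRel [Preorder β] (hr : IsPre r) {y : α → β} :
    Compat (insertRel r a b) y ↔ Compat r y ∧ y a ≤ y b := by
  constructor
  · intro h
    exact ⟨fun i j hij => h i j (Or.inl hij), h a b (Or.inr ⟨hr.refl a, hr.refl b⟩)⟩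
  · rintro ⟨h, hab⟩ i j (hij | ⟨h1, h2⟩)
    · exact h i j hij
    · exact (h i a h1).trans (hab.trans (h b j h2))

/-- As `r b a` fails, adding a ≤ b merges no classes, so every strict pair of r stays strict. -/
theorem strictCompat_insertRel [Preorder β] (hr : IsPre r) (hba : ¬ r b a) {y : α → β} :
    StrictCompat (insertRel r a b) y ↔ StrictCompat r y ∧ y a < y b := by
  constructor
  · intro h
    refine ⟨fun i j hij => ⟨(h i j (Or.inl hij)).1, fun hji => (h i j (Or.inl hij)).2 ?_⟩,
      (h a b (Or.inr ⟨hr.refl a, hr.refl b⟩)).2 ?_⟩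
    · rintro (h1 | ⟨h1, h2⟩)
      · exact hji h1
      · exact hba (hr.trans _ _ _ h2 (hr.trans _ _ _ hij h1))
    · rintro (h1 | ⟨h1, h2⟩)
      · exact hba h1
      · exact hba h1
  · rintro ⟨h, hab⟩ i j (hij | ⟨h1, h2⟩)
    · exact ⟨(h i j hij).1, fun hji => (h i j hij).2 fun h' => hji (Or.inl h')⟩
    · have := ((h i a h1).1.trans_lt (hab.trans_le (h b j h2).1))
      exact ⟨this.le, fun _ => this⟩

theorem strictCompat_insertRel_insertRel [PartialOrder β] (hr : IsPre r) (hab : ¬ r a b)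
    (hba : ¬ r b a) {y : α → β} :
    StrictCompat (insertRel (insertRel r a b) b a) y ↔ StrictCompat r y ∧ y a = y b := by
  have hr' := (hr.insertRel a b).insertRel b a
  have hsub : ∀ i j, r i j → insertRel (insertRel r a b) b a i j := fun i j h => Or.inl (Or.inl h)
  have h1 : insertRel (insertRel r a b) b a a b :=
    Or.inl (Or.inr ⟨hr.refl a, hr.refl b⟩)
  have h2 : insertRel (insertRel r a b) b a b a :=
    Or.inr ⟨Or.inl (hr.refl b), Or.inl (hr.refl a)⟩
  have htr := hr.trans
  constructor
  · intro h
    refine ⟨fun i j hij => ⟨(h i j (hsub _ _ hij)).1, fun hji => (h i j (hsub _ _ hij)).2 ?_⟩,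
      le_antisymm (h a b h1).1 (h b a h2).1⟩
    unfold insertRel
    grind
  · rintro ⟨h, hy⟩ i j hij
    have hc : Compat (insertRel (insertRel r a b) b a) y :=
      (compat_insertRel (hr.insertRel a b)).2 ⟨(compat_insertRel hr).2 ⟨h.compat, hy.le⟩, hy.ge⟩
    refine ⟨hc i j hij, fun hji => ?_⟩
    -- In the chain i ≤ c, e ≤ j with c and e merged, at least one of the two links is strict;
    -- otherwise j would lie below i in the merged preorder.
    have key : ∀ c e, r i c → r e j → y c = y e →
        insertRel (insertRel r a b) b a e c → y i < y j := by
      intro c e hic hej hce hec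
      have hlt : ¬ (r c i ∧ r j e) := fun ⟨h3, h4⟩ =>
        hji (hr'.trans _ _ _ (hr'.trans _ _ _ (hsub _ _ h4) hec) (hsub _ _ h3))
      by_cases hci : r c i
      · exact ((h i c hic).1.trans hce.le).trans_lt ((h e j hej).2 fun h4 => hlt ⟨hci, h4⟩)
      · exact ((h i c hic).2 hci).trans_le (hce.le.trans (h e j hej).1)
    rcases hij with (hij | ⟨h3, h4⟩) | ⟨h3 | ⟨h3, -⟩, h4 | ⟨-, h4⟩⟩
    · exact (h i j hij).2 fun h' => hji (hsub _ _ h')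
    · exact key a b h3 h4 hy h2
    · exact key b a h3 h4 hy.symm h1
    · exact key b b h3 h4 rfl (hr'.refl b)
    · exact key a a h3 h4 rfl (hr'.refl a)
    · exact key a b h3 h4 hy h2

end Splitting

/-! ### The span of a preorder cone and its dimension -/

/-- The functions that are constant on the classes of the preorder `r`. -/
def levelSubspace {α : Type*} (r : α → α → Prop) : Submodule ℝ (α → ℝ) where
  carrier := {y | ∀ i j, r i j → r j i → y i = y j}
  add_mem' := by
    intro x y hx hy i j hij hji
    simp [hx i j hij hji, hy i j hij hji]
  zero_mem' := by intro i j _ _; rfl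
  smul_mem' := by
    intro c x hx i j hij hji
    simp [hx i j hij hji]

theorem mem_levelSubspace {α : Type*} {r : α → α → Prop} {y : α → ℝ} :
    y ∈ levelSubspace r ↔ ∀ i j, r i j → r j i → y i = y j := Iff.rfl

section Level

variable {α : Type*} {r : α → α → Prop} {a b : α}

theorem levelSubspace_insertRel (hr : IsPre r) (hba : ¬ r b a) :
    levelSubspace (insertRel r a b) = levelSubspace r := by
  have htr := hr.trans
  ext y
  simp only [mem_levelSubspace, insertRel]
  constructor
  · intro h i j hij hji
    exact h i j (Or.inl hij) (Or.inl hji)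
  · intro h i j hij hji
    apply h i j <;> grind

/-- Since no class lies strictly between a and b, reversing the relation merges exactly these two
classes and imposes a single new equation. -/
theorem mem_levelSubspace_insertRel_of_cover (hr : IsPre r) (hab : r a b)
    (hcov : ∀ i, r a i → r i b → r i a ∨ r b i) {y : α → ℝ} :
    y ∈ levelSubspace (insertRel r b a) ↔ y ∈ levelSubspace r ∧ y a = y b := by
  have htr := hr.trans
  have hrf := hr.refl
  simp only [mem_levelSubspace, insertRel]
  constructor
  · intro h
    exact ⟨fun i j hij hji => h i j (Or.inl hij) (Or.inl hji),
      h a b (Or.inl hab) (Or.inr ⟨hrf b, hrf a⟩)⟩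
  · rintro ⟨h, hy⟩ i j hij hji
    have key : ∀ i, r a i → r i b → y i = y a := by
      intro i h1 h2
      rcases hcov i h1 h2 with h3 | h3
      · exact h i a h3 h1
      · exact (h i b h2 h3).trans hy.symm
    rcases hij with hij | ⟨h1, h2⟩ <;> rcases hji with hji | ⟨h3, h4⟩
    · exact h i j hij hji
    · rw [key i h4 (htr _ _ _ hij h3), key j (htr _ _ _ h4 hij) h3]
    · rw [key j h2 (htr _ _ _ hji h1), key i (htr _ _ _ h2 hji) h1]
    · rw [key i h4 h1, key j h2 h3]

theorem finrank_levelSubspace_insertRel_of_cover [Finite α] (hr : IsPre r) (hab : r a b)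
    (hba : ¬ r b a) (hcov : ∀ i, r a i → r i b → r i a ∨ r b i) :
    Module.finrank ℝ (levelSubspace (insertRel r b a)) + 1 =
      Module.finrank ℝ (levelSubspace r) := by
  classical
  let φ : Module.Dual ℝ (levelSubspace r) :=
    ((LinearMap.proj a : (α → ℝ) →ₗ[ℝ] ℝ) - LinearMap.proj b) ∘ₗ (levelSubspace r).subtype
  have hφ : φ ≠ 0 := by
    intro h
    -- The indicator of the up-set of b is constant on classes and separates a from b.
    let z : α → ℝ := fun i => if r b i then 1 else 0
    have hz : z ∈ levelSubspace r := by
      intro i j hij hji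
      have : r b i ↔ r b j := ⟨fun h => hr.trans _ _ _ h hij, fun h => hr.trans _ _ _ h hji⟩
      simp [z, this]
    have := LinearMap.congr_fun h ⟨z, hz⟩
    simp [φ, z, hba, hr.refl b] at this
  rw [← Module.Dual.finrank_ker_add_one_of_ne_zero hφ]
  congr 1
  have : levelSubspace (insertRel r b a) = (LinearMap.ker φ).map (levelSubspace r).subtype := by
    ext y
    rw [mem_levelSubspace_insertRel_of_cover hr hab hcov]
    simp [φ, sub_eq_zero]
    tauto
  rw [this, Submodule.finrank_map_subtype_eq]

/-- Once a ≤ b is added to an incomparable pair, b covers a, which reduces this to the cover case.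
-/
theorem finrank_levelSubspace_merge [Finite α] (hr : IsPre r) (hab : ¬ r a b) (hba : ¬ r b a) :
    Module.finrank ℝ (levelSubspace (insertRel (insertRel r a b) b a)) + 1 =
      Module.finrank ℝ (levelSubspace r) := by
  rw [← levelSubspace_insertRel hr hba]
  have htr := hr.trans
  have hrf := hr.refl
  apply finrank_levelSubspace_insertRel_of_cover (hr.insertRel a b)
  · exact Or.inr ⟨hrf a, hrf b⟩
  · unfold insertRel; grind
  · intro i; unfold insertRel; grind

theorem finrank_levelSubspace_of_surjective {β : Type*} [Fintype β] {g : α → β}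
    (hg : Function.Surjective g) (h : ∀ i j, (r i j ∧ r j i) ↔ g i = g j) :
    Module.finrank ℝ (levelSubspace r) = Fintype.card β := by
  have : levelSubspace r = LinearMap.range (LinearMap.funLeft ℝ ℝ g) := by
    ext y
    rw [mem_levelSubspace, LinearMap.mem_range]
    constructor
    · intro hy
      refine ⟨fun b => y (Function.surjInv hg b), ?_⟩
      ext i
      have := (h (Function.surjInv hg (g i)) i).2 (Function.surjInv_eq hg _)
      exact hy _ _ this.1 this.2
    · rintro ⟨z, rfl⟩ i j hij hji
      simp [LinearMap.funLeft, (h i j).1 ⟨hij, hji⟩]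
  rw [this, LinearMap.finrank_range_of_inj (LinearMap.funLeft_injective_of_surjective ℝ ℝ g hg)]
  simp

end Level

/-! ### Counting monotone maps; total preorders -/

section Counting

open Classical in
/-- The maps to `{1, …, m}` that are weakly increasing along `r`. -/
noncomputable def weakMaps {α : Type*} [Fintype α] (r : α → α → Prop) (m : ℕ) :
    Finset (α → ℕ) :=
  (Fintype.piFinset fun _ => Finset.Icc 1 m).filter fun y => Compat r y

open Classical in
/-- The maps to `{1, …, m}` that are strictly increasing along `r`. -/
noncomputable def strictMaps {α : Type*} [Fintype α] (r : α → α → Prop) (m : ℕ) :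
    Finset (α → ℕ) :=
  (Fintype.piFinset fun _ => Finset.Icc 1 m).filter fun y => StrictCompat r y

theorem mem_weakMaps {α : Type*} [Fintype α] {r : α → α → Prop} {m : ℕ} {y : α → ℕ} :
    y ∈ weakMaps r m ↔ (∀ i, 1 ≤ y i ∧ y i ≤ m) ∧ Compat r y := by
  simp [weakMaps]

theorem mem_strictMaps {α : Type*} [Fintype α] {r : α → α → Prop} {m : ℕ} {y : α → ℕ} :
    y ∈ strictMaps r m ↔ (∀ i, 1 ≤ y i ∧ y i ≤ m) ∧ StrictCompat r y := by
  simp [strictMaps]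

theorem card_strictMaps_fin (c m : ℕ) :
    (strictMaps (fun i j : Fin c => i ≤ j) m).card = m.choose c := by
  have hm : ∀ y : Fin c → ℕ, StrictCompat (fun i j : Fin c => i ≤ j) y ↔ StrictMono y := by
    intro y
    constructor
    · intro h i j hij
      exact (h i j hij.le).2 (not_le.2 hij)
    · intro h i j hij
      exact ⟨h.monotone hij, fun h' => h (not_le.1 h')⟩
  have : (Finset.powersetCard c (Finset.Icc 1 m)).card = m.choose c := by simp
  rw [← this]
  refine Finset.card_bij (fun y _ => Finset.univ.image y) ?_ ?_ ?_
  · intro y hy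
    rw [mem_strictMaps, hm] at hy
    rw [Finset.mem_powersetCard, Finset.card_image_of_injective _ hy.2.injective]
    refine ⟨?_, by simp⟩
    intro x hx
    obtain ⟨i, -, rfl⟩ := Finset.mem_image.1 hx
    exact Finset.mem_Icc.2 (hy.1 i)
  · intro y hy z hz h
    rw [mem_strictMaps, hm] at hy hz
    have hc : (Finset.univ.image y).card = c := by
      rw [Finset.card_image_of_injective _ hy.2.injective]; simp
    rw [Finset.orderEmbOfFin_unique hc (f := y) (by simp) hy.2,
      Finset.orderEmbOfFin_unique hc (f := z) (fun i => by simp [h]) hz.2]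
  · intro s hs
    rw [Finset.mem_powersetCard] at hs
    refine ⟨s.orderEmbOfFin hs.2, ?_, ?_⟩
    · rw [mem_strictMaps, hm]
      exact ⟨fun i => Finset.mem_Icc.1 (hs.1 (Finset.orderEmbOfFin_mem s hs.2 i)),
        (s.orderEmbOfFin hs.2).strictMono⟩
    · rw [← Finset.coe_inj]; simp

/-- Adding i to the i-th value turns weakly increasing maps into strictly increasing ones with
values up to m + c - 1. -/
theorem card_weakMaps_fin (c m : ℕ) :
    (weakMaps (fun i j : Fin c => i ≤ j) m).card = (m + c - 1).choose c := by
  rw [← card_strictMaps_fin]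
  refine Finset.card_bij (fun y _ i => y i + i) ?_ ?_ ?_
  · intro y hy
    rw [mem_weakMaps] at hy
    rw [mem_strictMaps]
    refine ⟨fun i => ?_, fun i j hij => ?_⟩
    · have := hy.1 i
      have := i.2
      omega
    · have := hy.2 i j hij
      dsimp only
      have hij' : (i : ℕ) ≤ j := hij
      refine ⟨by omega, fun h => ?_⟩
      have : (i : ℕ) < j := not_le.1 h
      omega
  · intro y _ z _ h
    funext i
    have := congrFun h i
    simpa using this
  · intro y hy
    rw [mem_strictMaps] at hy
    have hmono : ∀ i j : Fin c, i ≤ j → y i + (j : ℕ) ≤ y j + (i : ℕ) := by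
      intro i j hij
      obtain ⟨j, hj⟩ := j
      induction j with
      | zero => have : i = ⟨0, hj⟩ := le_antisymm hij (Fin.mk_le_of_le_val (Nat.zero_le _))
                rw [this]
      | succ j ih =>
        rcases hij.eq_or_lt with rfl | hlt
        · rfl
        · have hlt' : (i : ℕ) < j + 1 := hlt
          have h1 := ih (by omega) (Nat.lt_succ_iff.1 hlt')
          have h2 := (hy.2 ⟨j, by omega⟩ ⟨j + 1, hj⟩ (Nat.le_succ j)).2 (by simp)
          simp only at h1 ⊢
          omega
    have hlow : ∀ i : Fin c, (i : ℕ) + 1 ≤ y i := by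
      intro i
      have hc : 0 < c := i.pos
      have h1 := hmono ⟨0, hc⟩ i (Fin.mk_le_of_le_val (Nat.zero_le _))
      have h2 := (hy.1 ⟨0, hc⟩).1
      simp only at h1
      omega
    refine ⟨fun i => y i - i, ?_, ?_⟩
    · rw [mem_weakMaps]
      refine ⟨fun i => ?_, fun i j hij => ?_⟩
      · have h1 := hlow i
        have hi := i.2
        have h2 := hmono i ⟨c - 1, by omega⟩ (Nat.le_sub_one_of_lt hi)
        have h3 := (hy.1 ⟨c - 1, by omega⟩).2
        simp only at h2
        omega
      · have := hmono i j hij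
        have := hlow i
        have := hlow j
        show y i - i ≤ y j - j
        omega
    · funext i
      have := hlow i
      show y i - i + i = y i
      omega

/-- Compatible maps are constant on the fibres of g, so they factor uniquely through it. -/
theorem card_strictMaps_and_weakMaps_of_surjective {α β : Type*} [Fintype α] [Fintype β]
    {g : α → β} (hg : Function.Surjective g) (m : ℕ) {r : α → α → Prop} {s : β → β → Prop}
    (hs : ∀ b, s b b) (h : ∀ i j, r i j ↔ s (g i) (g j)) :
    (strictMaps r m).card = (strictMaps s m).card ∧ (weakMaps r m).card = (weakMaps s m).card := by
  have hcomp : ∀ z : β → ℕ, Compat r (z ∘ g) ↔ Compat s z := by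
    intro z
    simp only [Compat, h, Function.comp_apply]
    exact ⟨fun H => hg.forall₂.2 H, fun H => hg.forall₂.1 H⟩
  have hscomp : ∀ z : β → ℕ, StrictCompat r (z ∘ g) ↔ StrictCompat s z := by
    intro z
    simp only [StrictCompat, h, Function.comp_apply]
    exact ⟨fun H => hg.forall₂.2 H, fun H => hg.forall₂.1 H⟩
  have hbd : ∀ z : β → ℕ, (∀ i, 1 ≤ (z ∘ g) i ∧ (z ∘ g) i ≤ m) ↔ ∀ i, 1 ≤ z i ∧ z i ≤ m :=
    fun z => ⟨fun H => hg.forall.2 H, fun H => hg.forall.1 H⟩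
  have hfac : ∀ y : α → ℕ, Compat r y → ∃ z : β → ℕ, z ∘ g = y := by
    intro y hy
    refine ⟨fun b => y (Function.surjInv hg b), ?_⟩
    funext i
    have he : g (Function.surjInv hg (g i)) = g i := Function.surjInv_eq hg _
    refine le_antisymm (hy _ _ ((h _ _).2 ?_)) (hy _ _ ((h _ _).2 ?_)) <;> rw [he] <;> exact hs _
  constructor
  · symm
    refine Finset.card_bij (fun z _ => z ∘ g) ?_ ?_ ?_
    · intro z hz
      rw [mem_strictMaps] at hz ⊢
      rwa [hbd, hscomp]
    · intro z _ z' _ hzz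
      exact hg.injective_comp_right hzz
    · intro y hy
      rw [mem_strictMaps] at hy
      obtain ⟨z, rfl⟩ := hfac y hy.2.compat
      rw [hbd, hscomp] at hy
      exact ⟨z, mem_strictMaps.2 hy, rfl⟩
  · symm
    refine Finset.card_bij (fun z _ => z ∘ g) ?_ ?_ ?_
    · intro z hz
      rw [mem_weakMaps] at hz ⊢
      rwa [hbd, hcomp]
    · intro z _ z' _ hzz
      exact hg.injective_comp_right hzz
    · intro y hy
      rw [mem_weakMaps] at hy
      obtain ⟨z, rfl⟩ := hfac y hy.2
      rw [hbd, hcomp] at hy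
      exact ⟨z, mem_weakMaps.2 hy, rfl⟩

theorem exists_rank_of_total {α : Type*} [Fintype α] {r : α → α → Prop} (hr : IsPre r)
    (htot : ∀ i j, r i j ∨ r j i) :
    ∃ (c : ℕ) (g : α → Fin c), Function.Surjective g ∧ ∀ i j, r i j ↔ g i ≤ g j := by
  classical
  let _ : Preorder α := { le := r, le_refl := hr.refl, le_trans := hr.trans }
  have : @Std.Total α (· ≤ ·) := ⟨htot⟩
  have : DecidableLE α := Classical.decRel _
  have : DecidableLT α := Classical.decRel _
  let _ : Fintype (Antisymmetrization α (· ≤ ·)) :=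
    @Fintype.ofFinite _ (Quotient.finite _)
  let e := Fintype.orderIsoFinOfCardEq (Antisymmetrization α (· ≤ ·)) rfl
  refine ⟨_, fun i => e.symm (toAntisymmetrization (· ≤ ·) i), ?_, ?_⟩
  · exact e.symm.surjective.comp (Quotient.mk_surjective)
  · intro i j
    rw [e.symm.le_iff_le]
    exact (toAntisymmetrization_le_toAntisymmetrization_iff (a := i) (b := j)).symm

end Counting

/-! ### Order polynomials and reciprocity -/

theorem exists_choose_polynomial (c : ℕ) : ∃ p : ℚ[X],
    (∀ m : ℕ, 0 < m → p.eval (m : ℚ) = (m.choose c : ℚ)) ∧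
    (∀ m : ℕ, 0 < m → (-1 : ℚ) ^ c * p.eval (-(m : ℚ)) = ((m + c - 1).choose c : ℚ)) ∧
    p.natDegree ≤ c ∧ 0 < p.coeff c := by
  have hf : (0 : ℚ) < (c.factorial : ℚ) := by exact_mod_cast c.factorial_pos
  refine ⟨C ((c.factorial : ℚ)⁻¹) * descPochhammer ℚ c, ?_, ?_, ?_, ?_⟩
  · intro m _
    rw [eval_C_mul, descPochhammer_eval_eq_descFactorial, Nat.descFactorial_eq_factorial_mul_choose]
    push_cast
    field_simp
  · intro m hm
    have h1 := ascPochhammer_eval_neg_eq_descPochhammer (R := ℚ) (-(m : ℚ)) c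
    rw [neg_neg] at h1
    rw [eval_C_mul, mul_left_comm, ← h1, ← ascPochhammer_eval_cast,
      ascPochhammer_nat_eq_descFactorial,
      Nat.descFactorial_eq_factorial_mul_choose]
    push_cast
    field_simp
  · exact (natDegree_C_mul_le _ _).trans (descPochhammer_natDegree ℚ c).le
  · have := (monic_descPochhammer ℚ c).coeff_natDegree
    rw [descPochhammer_natDegree] at this
    rw [coeff_C_mul, this, mul_one]
    positivity

section OrderPolynomial

variable {α : Type*} [Fintype α] {r : α → α → Prop} {a b : α}

theorem card_strictMaps_split (hr : IsPre r) (hab : ¬ r a b) (hba : ¬ r b a) (m : ℕ) :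
    (strictMaps r m).card = (strictMaps (insertRel r a b) m).card +
      (strictMaps (insertRel r b a) m).card +
      (strictMaps (insertRel (insertRel r a b) b a) m).card := by
  classical
  rw [← Finset.card_union_of_disjoint, ← Finset.card_union_of_disjoint]
  · congr 1
    ext y
    simp only [Finset.mem_union, mem_strictMaps, strictCompat_insertRel hr hba,
      strictCompat_insertRel hr hab, strictCompat_insertRel_insertRel hr hab hba]
    have := lt_trichotomy (y a) (y b)
    tauto
  · rw [Finset.disjoint_left]
    intro y
    simp only [Finset.mem_union, mem_strictMaps, strictCompat_insertRel hr hba,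
      strictCompat_insertRel hr hab, strictCompat_insertRel_insertRel hr hab hba]
    rintro (⟨-, -, h⟩ | ⟨-, -, h⟩) ⟨-, -, h'⟩ <;> omega
  · rw [Finset.disjoint_left]
    intro y
    simp only [mem_strictMaps, strictCompat_insertRel hr hba, strictCompat_insertRel hr hab]
    rintro ⟨-, -, h⟩ ⟨-, -, h'⟩
    omega

/-- Inclusion-exclusion: y a ≤ y b and y b ≤ y a together cover everything and overlap where the
values agree. The merged term has the opposite sign from the strict split, matching its loss of one
class in the reciprocity sign. -/
theorem card_weakMaps_split (hr : IsPre r) (a b : α) (m : ℕ) :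
    (weakMaps (insertRel r a b) m).card + (weakMaps (insertRel r b a) m).card =
      (weakMaps r m).card + (weakMaps (insertRel (insertRel r a b) b a) m).card := by
  classical
  rw [← Finset.card_union_add_card_inter]
  congr 2
  · ext y
    simp only [Finset.mem_union, mem_weakMaps, compat_insertRel hr]
    have := le_total (y a) (y b)
    tauto
  · ext y
    simp only [Finset.mem_inter, mem_weakMaps, compat_insertRel hr,
      compat_insertRel (hr.insertRel a b)]
    tauto

/-- Reciprocity for the order polynomial of a finite preorder. -/
theorem exists_orderPolynomial (hr : IsPre r) : ∃ p : ℚ[X],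
    (∀ m : ℕ, 0 < m → p.eval (m : ℚ) = ((strictMaps r m).card : ℚ)) ∧
    (∀ m : ℕ, 0 < m → (-1 : ℚ) ^ Module.finrank ℝ (levelSubspace r) * p.eval (-(m : ℚ)) =
      ((weakMaps r m).card : ℚ)) ∧
    p.natDegree ≤ Module.finrank ℝ (levelSubspace r) ∧
    0 < p.coeff (Module.finrank ℝ (levelSubspace r)) := by
  classical
  -- Each of the three refinements has fewer unrelated ordered pairs.
  induction hn : (Finset.univ.filter fun q : α × α => ¬ r q.1 q.2).card using
    Nat.strong_induction_on generalizing r with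
  | _ n ih =>
  by_cases htot : ∀ i j, r i j ∨ r j i
  · obtain ⟨c, g, hg, hgr⟩ := exists_rank_of_total hr htot
    have hc : Module.finrank ℝ (levelSubspace r) = c := by
      rw [finrank_levelSubspace_of_surjective hg, Fintype.card_fin]
      intro i j
      rw [hgr, hgr, ← le_antisymm_iff]
    obtain ⟨p, h1, h2, h3, h4⟩ := exists_choose_polynomial c
    rw [hc]
    refine ⟨p, fun m hm => ?_, fun m hm => ?_, h3, h4⟩
    · rw [h1 m hm, (card_strictMaps_and_weakMaps_of_surjective hg m
        (s := fun i j => i ≤ j) le_refl hgr).1, card_strictMaps_fin]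
    · rw [h2 m hm, (card_strictMaps_and_weakMaps_of_surjective hg m
        (s := fun i j => i ≤ j) le_refl hgr).2, card_weakMaps_fin]
  · push Not at htot
    obtain ⟨a, b, hab, hba⟩ := htot
    have hlt : ∀ r' : α → α → Prop, (∀ i j, r i j → r' i j) → (r' a b ∨ r' b a) →
        (Finset.univ.filter fun q : α × α => ¬ r' q.1 q.2).card < n := by
      intro r' hsub hor
      rw [← hn]
      apply Finset.card_lt_card
      rw [Finset.ssubset_iff_of_subset]
      · rcases hor with h | h
        · exact ⟨(a, b), by simpa using hab, by simpa using h⟩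
        · exact ⟨(b, a), by simpa using hba, by simpa using h⟩
      · intro q
        simp only [Finset.mem_filter, Finset.mem_univ, true_and]
        exact fun h h' => h (hsub _ _ h')
    have hA : insertRel r a b a b := Or.inr ⟨hr.refl a, hr.refl b⟩
    have hB : insertRel r b a b a := Or.inr ⟨hr.refl b, hr.refl a⟩
    obtain ⟨p, p1, p2, p3, p4⟩ := ih _ (hlt (insertRel r a b) (fun _ _ => Or.inl) (Or.inl hA))
      (hr.insertRel a b) rfl
    obtain ⟨q, q1, q2, q3, q4⟩ := ih _ (hlt (insertRel r b a) (fun _ _ => Or.inl) (Or.inr hB))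
      (hr.insertRel b a) rfl
    obtain ⟨s, s1, s2, s3, s4⟩ := ih _ (hlt (insertRel (insertRel r a b) b a)
      (fun _ _ h => Or.inl (Or.inl h)) (Or.inl (Or.inl hA)))
      ((hr.insertRel a b).insertRel b a) rfl
    have hc := finrank_levelSubspace_merge hr hab hba
    rw [levelSubspace_insertRel hr hba] at p2 p3 p4
    rw [levelSubspace_insertRel hr hab] at q2 q3 q4
    rw [← hc] at p2 p3 p4 q2 q3 q4 ⊢
    refine ⟨p + q + s, fun m hm => ?_, fun m hm => ?_, ?_, ?_⟩
    · rw [card_strictMaps_split hr hab hba, eval_add, eval_add, p1 m hm, q1 m hm, s1 m hm]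
      push_cast
      rfl
    · have h := card_weakMaps_split hr a b m
      have h' : ((weakMaps (insertRel r a b) m).card : ℚ) + (weakMaps (insertRel r b a) m).card =
        (weakMaps r m).card + (weakMaps (insertRel (insertRel r a b) b a) m).card := by
        exact_mod_cast h
      rw [← p2 m hm, ← q2 m hm, ← s2 m hm] at h'
      rw [eval_add, eval_add, pow_succ]
      rw [pow_succ] at h'
      linear_combination h'
    · exact (natDegree_add_le_of_degree_le (natDegree_add_le_of_degree_le p3 q3)
        (s3.trans (Nat.le_succ _)))
    -- The merged preorder has one class fewer, so its polynomial does not reach the top degree.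
    · rw [coeff_add, coeff_add, coeff_eq_zero_of_natDegree_lt (Nat.lt_succ_of_le s3)]
      linarith

end OrderPolynomial

/-! ### Maximal faces of polytopes -/

namespace GenPerm

/-- Elementary substitute for Farkas' lemma: it supplies every "sufficiently large multiple" in the
perturbation arguments. -/
theorem exists_le_mul_of_finite {ι : Type*} {S : Set ι} (hS : S.Finite) (f g : ι → ℝ)
    (hf : ∀ s ∈ S, 0 ≤ f s) (h : ∀ s ∈ S, f s = 0 → g s ≤ 0) :
    ∃ K : ℝ, 0 ≤ K ∧ ∀ s ∈ S, g s ≤ K * f s := by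
  obtain ⟨M, hM⟩ := (hS.image fun s => g s / f s).bddAbove
  refine ⟨max M 0, le_max_right _ _, fun s hs => ?_⟩
  rcases (hf s hs).eq_or_lt with h0 | h0
  · rw [← h0, mul_zero]
    exact h s hs h0.symm
  · rw [← div_le_iff₀ h0]
    exact (hM (Set.mem_image_of_mem _ hs)).trans (le_max_left _ _)

variable {d : ℕ} {P F : Set (Fin d → ℝ)}

theorem pairing_eq_dotProduct (y x : Fin d → ℝ) : pairing y x = x ⬝ᵥ y := rfl

theorem pairing_add_smul (w z : Fin d → ℝ) (K : ℝ) (x : Fin d → ℝ) :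
    pairing (w + K • z) x = pairing w x + K * pairing z x := by
  simp [pairing_eq_dotProduct, dotProduct_add, dotProduct_smul]

theorem pairing_add (w z x : Fin d → ℝ) : pairing (w + z) x = pairing w x + pairing z x := by
  simp [pairing_eq_dotProduct, dotProduct_add]

theorem pairing_neg (w x : Fin d → ℝ) : pairing (-w) x = -pairing w x := by
  simp [pairing_eq_dotProduct]

theorem isLinearMap_pairing (y : Fin d → ℝ) : IsLinearMap ℝ (pairing y) where
  map_add x x' := by simp [pairing_eq_dotProduct, add_dotProduct]
  map_smul c x := by simp [pairing_eq_dotProduct, smul_dotProduct]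

theorem pairing_le_of_mem_convexHull {S : Set (Fin d → ℝ)} {a : Fin d → ℝ} {b : ℝ}
    (h : ∀ s ∈ S, pairing a s ≤ b) {x : Fin d → ℝ} (hx : x ∈ convexHull ℝ S) :
    pairing a x ≤ b :=
  convexHull_min (t := {x | pairing a x ≤ b}) h
    (convex_halfSpace_le (isLinearMap_pairing a) b) hx

theorem maxFace_subset (P : Set (Fin d → ℝ)) (y : Fin d → ℝ) : maxFace P y ⊆ P := fun _ h => h.1

theorem pairing_eq_of_mem_maxFace {y x x' : Fin d → ℝ} (hx : x ∈ maxFace P y)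
    (hx' : x' ∈ maxFace P y) : pairing y x = pairing y x' :=
  le_antisymm (hx'.2 x hx.1) (hx.2 x' hx'.1)

theorem mem_maxFace_of_le {y x x' : Fin d → ℝ} (hx : x ∈ maxFace P y) (hx' : x' ∈ P)
    (h : pairing y x ≤ pairing y x') : x' ∈ maxFace P y :=
  ⟨hx', fun u hu => (hx.2 u hu).trans h⟩

theorem IsPolytope.maxFace_nonempty (hP : IsPolytope P) (y : Fin d → ℝ) :
    (maxFace P y).Nonempty := by
  obtain ⟨S, hS, hne, rfl⟩ := hP
  obtain ⟨s, hs, hmax⟩ := Set.exists_max_image S (pairing y) hS hne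
  exact ⟨s, subset_convexHull ℝ S hs, fun x hx => pairing_le_of_mem_convexHull hmax hx⟩

theorem isFace_iff : IsFace P F ↔ F.Nonempty ∧ ∃ a, F = maxFace P a := by
  constructor
  · rintro ⟨⟨x₀, hx₀⟩, a, b, hab, rfl⟩
    refine ⟨⟨x₀, hx₀⟩, a, ?_⟩
    ext x
    constructor
    · rintro ⟨hx, hxb⟩
      exact ⟨hx, fun u hu => (hab u hu).trans hxb.ge⟩
    · rintro ⟨hx, hmax⟩
      exact ⟨hx, le_antisymm (hab x hx) (hx₀.2.ge.trans (hmax x₀ hx₀.1))⟩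
  · rintro ⟨⟨x₀, hx₀⟩, a, rfl⟩
    refine ⟨⟨x₀, hx₀⟩, a, pairing a x₀, hx₀.2, ?_⟩
    ext x
    exact ⟨fun hx => ⟨hx.1, pairing_eq_of_mem_maxFace hx hx₀⟩,
      fun hx => mem_maxFace_of_le hx₀ hx.1 hx.2.ge⟩

theorem IsPolytope.isFace_maxFace (hP : IsPolytope P) (y : Fin d → ℝ) :
    IsFace P (maxFace P y) :=
  isFace_iff.2 ⟨hP.maxFace_nonempty y, y, rfl⟩

/-- A face of a face of a polytope is maximized by a suitable perturbation. -/
theorem IsPolytope.maxFace_add_smul (hP : IsPolytope P) (w z : Fin d → ℝ)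
    (hne : (maxFace (maxFace P z) w).Nonempty) :
    ∃ K : ℝ, 0 < K ∧ maxFace P (w + K • z) = maxFace (maxFace P z) w := by
  obtain ⟨x₀, hx₀⟩ := hne
  obtain ⟨S, hS, hSne, rfl⟩ := hP
  obtain ⟨K, hK0, hK⟩ := exists_le_mul_of_finite hS
    (fun s => pairing z x₀ - pairing z s) (fun s => pairing w s - pairing w x₀)
    (fun s hs => sub_nonneg.2 (hx₀.1.2 s (subset_convexHull ℝ S hs)))
    (fun s hs h0 => sub_nonpos.2 (hx₀.2 s
      (mem_maxFace_of_le hx₀.1 (subset_convexHull ℝ S hs) (sub_eq_zero.1 h0).le)))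
  have hK' : ∀ x ∈ convexHull ℝ S,
      pairing w x + K * pairing z x ≤ pairing w x₀ + K * pairing z x₀ := by
    intro x hx
    rw [← pairing_add_smul]
    refine pairing_le_of_mem_convexHull (fun s hs => ?_) hx
    rw [pairing_add_smul]
    have := hK s hs
    linarith
  -- K alone makes x₀ maximal; the extra copy of z forces every other maximizer to maximize z as
  -- well.
  have hx₀max : x₀ ∈ maxFace (convexHull ℝ S) (w + (K + 1) • z) := by
    refine ⟨hx₀.1.1, fun x hx => ?_⟩
    rw [pairing_add_smul, pairing_add_smul]
    have := hK' x hx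
    have := hx₀.1.2 x hx
    linarith
  refine ⟨K + 1, by linarith, ?_⟩
  ext x
  constructor
  · intro hx
    have h1 := pairing_eq_of_mem_maxFace hx hx₀max
    rw [pairing_add_smul, pairing_add_smul] at h1
    have h2 := hK' x hx.1
    have h3 := hx₀.1.2 x hx.1
    have h4 : pairing z x = pairing z x₀ := le_antisymm h3 (by linarith)
    rw [h4] at h1
    exact mem_maxFace_of_le hx₀ (mem_maxFace_of_le hx₀.1 hx.1 h4.ge) (by linarith)
  · intro hx
    refine mem_maxFace_of_le hx₀max hx.1.1 ?_
    rw [pairing_add_smul, pairing_add_smul, pairing_eq_of_mem_maxFace hx hx₀,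
      pairing_eq_of_mem_maxFace hx.1 hx₀.1]

theorem IsPolytope.isFace_maxFace_iff (hP : IsPolytope P) (y : Fin d → ℝ) :
    IsFace (maxFace P y) F ↔ IsFace P F ∧ F ⊆ maxFace P y := by
  constructor
  · intro h
    obtain ⟨hne, w, rfl⟩ := isFace_iff.1 h
    obtain ⟨K, -, hK⟩ := hP.maxFace_add_smul w y hne
    exact ⟨isFace_iff.2 ⟨hne, _, hK.symm⟩, maxFace_subset _ _⟩
  · rintro ⟨⟨hne, a, b, hab, rfl⟩, hsub⟩
    refine ⟨hne, a, b, fun x hx => hab x hx.1, ?_⟩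
    ext x
    exact ⟨fun hx => ⟨hsub hx, hx.2⟩, fun hx => ⟨hx.1.1, hx.2⟩⟩

/-- A functional constant on P_z does not change the face when added to a large multiple of z. -/
theorem IsPolytope.subset_maxFace_of_const (hP : IsPolytope P) {w z : Fin d → ℝ}
    (hw : ∀ x ∈ maxFace P z, ∀ x' ∈ maxFace P z, pairing w x = pairing w x') :
    ∃ K : ℝ, 0 < K ∧ maxFace P (w + K • z) = maxFace P z := by
  have h : maxFace (maxFace P z) w = maxFace P z := by
    ext x
    exact ⟨fun hx => hx.1, fun hx => ⟨hx, fun u hu => (hw u hu x hx).le⟩⟩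
  obtain ⟨K, hK, hKe⟩ := hP.maxFace_add_smul w z (h.symm ▸ hP.maxFace_nonempty z)
  exact ⟨K, hK, hKe.trans h⟩

/-! ### The normal fan of the standard permutahedron -/

section StdPermutahedron

/-- The vertex of the standard permutahedron given by `σ`. -/
def permVertex (σ : Equiv.Perm (Fin d)) : Fin d → ℝ := fun i => ((σ i : ℕ) : ℝ) + 1

theorem exists_monovary_permVertex (y : Fin d → ℝ) :
    ∃ σ : Equiv.Perm (Fin d), Monovary y (permVertex σ) := by
  refine ⟨(Tuple.sort y)⁻¹, fun i j hij => ?_⟩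
  have h : (Tuple.sort y)⁻¹ i < (Tuple.sort y)⁻¹ j := by
    simpa [permVertex] using hij
  simpa using Tuple.monotone_sort y h.le

/-- This is the rearrangement inequality with its equality case. -/
theorem pairing_permVertex_le {y : Fin d → ℝ} {σ : Equiv.Perm (Fin d)}
    (hσ : Monovary y (permVertex σ)) (τ : Equiv.Perm (Fin d)) :
    pairing y (permVertex τ) ≤ pairing y (permVertex σ) ∧
      (pairing y (permVertex τ) = pairing y (permVertex σ) ↔ Monovary y (permVertex τ)) := by
  have hτ : permVertex τ = permVertex σ ∘ (σ⁻¹ * τ : Equiv.Perm (Fin d)) := by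
    funext i
    simp [permVertex]
  have h1 := hσ.sum_mul_comp_perm_le_sum_mul (σ := σ⁻¹ * τ)
  have h2 := hσ.sum_mul_comp_perm_eq_sum_mul_iff (σ := σ⁻¹ * τ)
  rw [hτ, pairing_eq_dotProduct, pairing_eq_dotProduct, dotProduct_comm, dotProduct_comm _ y]
  exact ⟨h1, h2⟩

/-- The vertices on the y-maximal face are the permutations ordered consistently with y, and
coarsening the order of the values only admits more of them. -/
theorem maxFace_stdPermutahedron_subset {y y' : Fin d → ℝ}
    (h : ∀ i j, y i ≤ y j → y' i ≤ y' j) :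
    maxFace (stdPermutahedron d) y ⊆ maxFace (stdPermutahedron d) y' := by
  have hmono : ∀ σ : Equiv.Perm (Fin d), Monovary y (permVertex σ) →
      Monovary y' (permVertex σ) := fun σ hσ i j hij => h i j (hσ hij)
  obtain ⟨σ, hσ⟩ := exists_monovary_permVertex y
  have hσ' := hmono σ hσ
  have hstd : stdPermutahedron d = convexHull ℝ (Set.range (permVertex (d := d))) := rfl
  have hmem : ∀ τ : Equiv.Perm (Fin d), permVertex τ ∈ stdPermutahedron d := fun τ =>
    subset_convexHull ℝ _ ⟨τ, rfl⟩
  have hmax : permVertex σ ∈ maxFace (stdPermutahedron d) y' := by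
    refine ⟨hmem σ, fun x hx => ?_⟩
    refine pairing_le_of_mem_convexHull (S := Set.range (permVertex (d := d))) ?_ hx
    rintro _ ⟨τ, rfl⟩
    exact (pairing_permVertex_le hσ' τ).1
  -- Passing from vertices to arbitrary points: -y' + K y is maximal at σ, so a point with maximal
  -- y-value also has maximal y'-value.
  obtain ⟨K, hK0, hK⟩ := exists_le_mul_of_finite (Set.finite_range (permVertex (d := d)))
    (fun s => pairing y (permVertex σ) - pairing y s)
    (fun s => pairing y' (permVertex σ) - pairing y' s)
    (by
      rintro _ ⟨τ, rfl⟩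
      exact sub_nonneg.2 (pairing_permVertex_le hσ τ).1)
    (by
      rintro _ ⟨τ, rfl⟩ h0
      have h1 := (pairing_permVertex_le hσ τ).2.1 (sub_eq_zero.1 h0).symm
      exact (sub_eq_zero.2 ((pairing_permVertex_le hσ' τ).2.2 (hmono τ h1)).symm).le)
  intro x hx
  refine mem_maxFace_of_le hmax hx.1 ?_
  have hKx : pairing (-y' + K • y) x ≤ pairing (-y' + K • y) (permVertex σ) := by
    refine pairing_le_of_mem_convexHull (S := Set.range (permVertex (d := d))) ?_ hx.1
    intro s hs
    have := hK s hs
    rw [pairing_add_smul, pairing_add_smul, pairing_neg, pairing_neg]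
    linarith
  rw [pairing_add_smul, pairing_add_smul, pairing_neg, pairing_neg] at hKx
  have := mul_le_mul_of_nonneg_left (hx.2 _ (hmem σ)) hK0
  linarith

end StdPermutahedron

/-- The normal cone of F is a union of cones of the permutahedron's fan, and any such cone
containing y also contains y'. -/
theorem IsGeneralizedPermutahedron.subset_maxFace_of_coarser (hP : IsGeneralizedPermutahedron P)
    (hF : IsFace P F) {y y' : Fin d → ℝ} (h : ∀ i j, y i ≤ y j → y' i ≤ y' j)
    (hy : F ⊆ maxFace P y) : F ⊆ maxFace P y' := by
  obtain ⟨S, hS, hN⟩ := hP.2 (normalCone P F) ⟨F, hF, rfl⟩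
  have hy1 : y ∈ ⋃₀ S := hN ▸ hy
  obtain ⟨N, hNS, hyN⟩ := hy1
  obtain ⟨G, -, rfl⟩ := hS hNS
  have : y' ∈ ⋃₀ S := ⟨_, hNS, Set.Subset.trans hyN (maxFace_stdPermutahedron_subset h)⟩
  rw [← hN] at this
  exact this

end GenPerm

/-! ### Cones closed under coarsening are preorder cones -/

section Cone

variable {α : Type*} [Fintype α]

/-- A set of functions that is closed under addition and under coarsening of the weak order of
the values is cut out by inequalities between the values. -/
theorem mem_of_compat_of_coarsening {C : Set (α → ℝ)} (h0 : (0 : α → ℝ) ∈ C)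
    (hadd : ∀ x ∈ C, ∀ y ∈ C, x + y ∈ C)
    (hc : ∀ x ∈ C, ∀ y : α → ℝ, (∀ i j, x i ≤ x j → y i ≤ y j) → y ∈ C) {y : α → ℝ}
    (hy : Compat (fun i j => ∀ x ∈ C, x i ≤ x j) y) : y ∈ C := by
  classical
  let ind : Finset α → α → ℝ := fun U k => if k ∈ U then 1 else 0
  have hle : ∀ (U : Finset α) (i j : α), ind U i ≤ ind U j ↔ (i ∈ U → j ∈ U) := by
    intro U i j
    by_cases hi : i ∈ U <;> by_cases hj : j ∈ U <;> simp [ind, hi, hj]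
  -- The sum of two indicators takes values 0, 1, 2; intersection and union are its superlevel sets
  -- at 2 and 1, hence coarsenings.
  have hinter : ∀ U, ind U ∈ C → ∀ V, ind V ∈ C → ind (U ⊓ V) ∈ C := by
    intro U hU V hV
    refine hc _ (hadd _ hU _ hV) _ fun i j => ?_
    rw [hle]
    by_cases hi : i ∈ U <;> by_cases hj : j ∈ U <;> by_cases hi' : i ∈ V <;>
      by_cases hj' : j ∈ V <;> simp [ind, hi, hj, hi', hj']
  have hunion : ∀ U, ind U ∈ C → ∀ V, ind V ∈ C → ind (U ⊔ V) ∈ C := by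
    intro U hU V hV
    refine hc _ (hadd _ hU _ hV) _ fun i j => ?_
    rw [hle]
    by_cases hi : i ∈ U <;> by_cases hj : j ∈ U <;> by_cases hi' : i ∈ V <;>
      by_cases hj' : j ∈ V <;> simp [ind, hi, hj, hi', hj']
  have hbot : ind ⊥ ∈ C := hc _ h0 _ fun i j _ => by rw [hle]; simp
  have htop : ind ⊤ ∈ C := hc _ h0 _ fun i j _ => by rw [hle]; simp
  -- When i ≤ j fails at some x in C, the superlevel set of x at x i separates i from j; otherwise
  -- the whole set serves as a default.
  have hsep : ∀ i j, ∃ U, ind U ∈ C ∧ i ∈ U ∧ ((¬ ∀ x ∈ C, x i ≤ x j) → j ∉ U) := by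
    intro i j
    by_cases h : ∀ x ∈ C, x i ≤ x j
    · exact ⟨⊤, htop, by simp, fun h' => absurd h h'⟩
    · push Not at h
      obtain ⟨x, hx, hlt⟩ := h
      refine ⟨Finset.univ.filter fun k => x i ≤ x k, hc _ hx _ fun k l hkl => ?_, by simp,
        fun _ => by simpa using hlt⟩
      rw [hle]
      simpa using fun h => h.trans hkl
  choose U hUC hUi hUj using hsep
  -- A superlevel set of y is the union over i inside of the intersection over j outside of the sets
  -- `U i j`.
  have hlevel : ∀ t : ℝ, ind (Finset.univ.filter fun k => t ≤ y k) ∈ C := by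
    intro t
    have : (Finset.univ.filter fun k => t ≤ y k) =
        (Finset.univ.filter fun k => t ≤ y k).sup fun i =>
          (Finset.univ.filter fun k => ¬ t ≤ y k).inf fun j => U i j := by
      ext k
      simp only [Finset.mem_sup, Finset.mem_inf, Finset.mem_filter, Finset.mem_univ, true_and]
      constructor
      · intro hk
        exact ⟨k, hk, fun j _ => hUi k j⟩
      · rintro ⟨i, hi, h⟩
        by_contra hk
        refine hUj i k (fun hr => hk (hi.trans (hy i k hr))) (h k hk)
    rw [this]
    exact Finset.sup_induction (p := fun V => ind V ∈ C) hbot hunion fun i _ =>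
      Finset.inf_induction (p := fun V => ind V ∈ C) htop hinter fun j _ => hUC i j
  have hsum : ∀ T : Finset ℝ, (∑ t ∈ T, ind (Finset.univ.filter fun k => t ≤ y k)) ∈ C := by
    intro T
    exact Finset.sum_induction _ (· ∈ C) (fun a b ha hb => hadd a ha b hb) h0
      fun t _ => hlevel t
  -- The sum of the superlevel indicators over all values of y orders the coordinates exactly as y
  -- does.
  refine hc _ (hsum (Finset.univ.image y)) y fun i j hij => ?_
  by_contra hlt
  push Not at hlt
  refine absurd hij (not_le.2 ?_)
  rw [Finset.sum_apply, Finset.sum_apply]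
  refine Finset.sum_lt_sum (fun t _ => ?_) ⟨y i, by simp, ?_⟩
  · rw [hle]
    simpa using fun h => h.trans hlt.le
  · simp [ind, not_le.2 hlt]

theorem IsPre.exists_strictCompat {r : α → α → Prop} (hr : IsPre r) :
    ∃ y : α → ℝ, StrictCompat r y := by
  classical
  refine ⟨fun i => ((Finset.univ.filter fun k => r k i).card : ℝ), fun i j hij => ?_⟩
  have hsub : (Finset.univ.filter fun k => r k i) ⊆ Finset.univ.filter fun k => r k j := by
    intro k
    simpa using fun h => hr.trans _ _ _ h hij
  refine ⟨Nat.cast_le.2 (Finset.card_le_card hsub), fun hji => ?_⟩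
  have : (Finset.univ.filter fun k => r k i).card < (Finset.univ.filter fun k => r k j).card := by
    apply Finset.card_lt_card
    rw [Finset.ssubset_iff_of_subset hsub]
    exact ⟨j, by simpa using hr.refl j, by simpa using hji⟩
  exact Nat.cast_lt.2 this

/-- A large multiple of an interior point absorbs w along strict pairs, and w is constant along the
others. -/
theorem StrictCompat.exists_compat_add_smul {r : α → α → Prop} {z w : α → ℝ}
    (hz : StrictCompat r z) (hw : w ∈ levelSubspace r) : ∃ K : ℝ, Compat r (w + K • z) := by
  obtain ⟨K, -, hK⟩ := GenPerm.exists_le_mul_of_finite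
    (S := {q : α × α | r q.1 q.2}) (Set.toFinite _)
    (fun q => z q.2 - z q.1) (fun q => w q.1 - w q.2)
    (fun q hq => sub_nonneg.2 (hz _ _ hq).1)
    (fun q hq h0 => by
      have hji : r q.2 q.1 := by
        by_contra hji
        have := (hz _ _ hq).2 hji
        linarith
      exact (sub_eq_zero.2 (hw _ _ hq hji)).le)
  refine ⟨K, fun i j hij => ?_⟩
  have := hK (i, j) hij
  simp only at this
  simp only [Pi.add_apply, Pi.smul_apply, smul_eq_mul]
  linarith

end Cone

/-! ### Normal preorders of faces -/

namespace GenPerm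

variable {d : ℕ} {P F : Set (Fin d → ℝ)}

/-- The normal cone of `F` is the cone of the preorder `r`. -/
def IsNormalPreorder (P F : Set (Fin d → ℝ)) (r : Fin d → Fin d → Prop) : Prop :=
  IsPre r ∧ ∀ y, F ⊆ maxFace P y ↔ Compat r y

theorem subset_maxFace_add {y z : Fin d → ℝ} (hy : F ⊆ maxFace P y) (hz : F ⊆ maxFace P z) :
    F ⊆ maxFace P (y + z) := by
  intro x hx
  refine ⟨(hy hx).1, fun u hu => ?_⟩
  rw [pairing_add, pairing_add]
  exact add_le_add ((hy hx).2 u hu) ((hz hx).2 u hu)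

theorem IsGeneralizedPermutahedron.exists_isNormalPreorder (hP : IsGeneralizedPermutahedron P)
    (hF : IsFace P F) : ∃ r, IsNormalPreorder P F r := by
  refine ⟨fun i j => ∀ y ∈ {y | F ⊆ maxFace P y}, y i ≤ y j,
    ⟨fun i _ _ => le_rfl, fun i j k hij hjk y hy => (hij y hy).trans (hjk y hy)⟩, fun y => ?_⟩
  constructor
  · intro hy i j hij
    exact hij y hy
  · intro hy
    refine mem_of_compat_of_coarsening (C := {y | F ⊆ maxFace P y}) ?_ ?_ ?_ hy
    · obtain ⟨-, -, -, -, rfl⟩ := hF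
      intro x hx
      exact ⟨hx.1, fun u _ => by simp [pairing]⟩
    · exact fun y hy z hz => subset_maxFace_add hy hz
    · exact fun y hy z hyz => hP.subset_maxFace_of_coarser hF hyz hy

variable {r : Fin d → Fin d → Prop}

theorem mem_maxFace_of_mem_add_smul {y w x x₀ : Fin d → ℝ} {K : ℝ}
    (hx₀ : x₀ ∈ maxFace P (-w + K • y))
    (hw : x₀ ∈ maxFace P w) (hy₀ : x₀ ∈ maxFace P y) (hx : x ∈ maxFace P y) :
    x ∈ maxFace P w := by
  refine mem_maxFace_of_le hw hx.1 ?_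
  have := hx₀.2 x hx.1
  rw [pairing_add_smul, pairing_add_smul, pairing_neg, pairing_neg,
    pairing_eq_of_mem_maxFace hx hy₀] at this
  linarith

theorem mem_levelSubspace_of_compat {w : Fin d → ℝ} (hw : Compat r w) :
    w ∈ levelSubspace r := fun i j hij hji => le_antisymm (hw i j hij) (hw j i hji)

theorem IsNormalPreorder.maxFace_eq_iff (hP : IsPolytope P) (hF : IsFace P F)
    (hr : IsNormalPreorder P F r) (y : Fin d → ℝ) : maxFace P y = F ↔ StrictCompat r y := by
  constructor
  · rintro rfl i j hij
    have hyc : Compat r y := (hr.2 y).1 subset_rfl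
    refine ⟨hyc i j hij, fun hji => lt_of_le_of_ne (hyc i j hij) fun heq => hji ?_⟩
    by_contra hji
    -- If y tied a strict pair, an interior w would be constant on P_y, so some -w + K y would lie
    -- in the normal cone while reversing that pair.
    obtain ⟨w, hw⟩ := hr.1.exists_strictCompat
    have hwF : maxFace P y ⊆ maxFace P w := (hr.2 w).2 hw.compat
    obtain ⟨K, -, hKe⟩ := hP.subset_maxFace_of_const (w := -w) (z := y) fun x hx x' hx' => by
      rw [pairing_neg, pairing_neg, pairing_eq_of_mem_maxFace (hwF hx) (hwF hx')]
    have h1 := (hr.2 _).1 hKe.ge i j hij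
    have h2 := (hw i j hij).2 hji
    simp only [Pi.add_apply, Pi.neg_apply, Pi.smul_apply, smul_eq_mul, heq] at h1
    linarith
  · intro hy
    obtain ⟨⟨x₀, hx₀⟩, z, rfl⟩ := isFace_iff.1 hF
    have hz : Compat r z := (hr.2 z).1 subset_rfl
    have hzL : -z ∈ levelSubspace r := neg_mem (mem_levelSubspace_of_compat hz)
    -- With F = P_z, both z and -z + K y lie in the normal cone, which forces P_y ⊆ P_z.
    obtain ⟨K, hK⟩ := hy.exists_compat_add_smul hzL
    have hsub := (hr.2 y).2 hy.compat
    refine Set.Subset.antisymm (fun x hx => ?_) hsub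
    exact mem_maxFace_of_mem_add_smul ((hr.2 _).2 hK hx₀) hx₀ (hsub hx₀) hx

theorem IsNormalPreorder.mem_levelSubspace_iff (hP : IsPolytope P) (hF : IsFace P F)
    (hr : IsNormalPreorder P F r) (w : Fin d → ℝ) :
    w ∈ levelSubspace r ↔ ∀ x ∈ F, ∀ x' ∈ F, pairing w x = pairing w x' := by
  obtain ⟨-, z, rfl⟩ := isFace_iff.1 hF
  have hz : StrictCompat r z := (hr.maxFace_eq_iff hP hF z).1 rfl
  constructor
  · intro hw x hx x' hx'
    obtain ⟨K, hK⟩ := hz.exists_compat_add_smul hw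
    have hsub := (hr.2 _).2 hK
    have := pairing_eq_of_mem_maxFace (hsub hx) (hsub hx')
    rw [pairing_add_smul, pairing_add_smul, pairing_eq_of_mem_maxFace hx hx'] at this
    linarith
  · intro hw i j hij hji
    obtain ⟨K, -, hKe⟩ := hP.subset_maxFace_of_const hw
    have h1 := mem_levelSubspace_of_compat ((hr.2 _).1 hKe.ge) i j hij hji
    have h2 := mem_levelSubspace_of_compat hz.compat i j hij hji
    simp only [Pi.add_apply, Pi.smul_apply, smul_eq_mul, h2] at h1
    linarith

/-- The functionals constant on F form the annihilator of the direction space of its affine hull. -/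
theorem IsNormalPreorder.finrank_add_dim (hP : IsPolytope P) (hF : IsFace P F)
    (hr : IsNormalPreorder P F r) :
    Module.finrank ℝ (levelSubspace r) + dim F = d := by
  have hmap : (levelSubspace r).map (dotProductEquiv ℝ (Fin d)).toLinearMap =
      (affineSpan ℝ F).direction.dualAnnihilator := by
    rw [direction_affineSpan, vectorSpan_def]
    ext φ
    obtain ⟨w, rfl⟩ := (dotProductEquiv ℝ (Fin d)).surjective φ
    have h1 : dotProductEquiv ℝ (Fin d) w ∈
        (levelSubspace r).map (dotProductEquiv ℝ (Fin d)).toLinearMap ↔ w ∈ levelSubspace r := by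
      constructor
      · rintro ⟨w', hw', he⟩
        rwa [← (dotProductEquiv ℝ (Fin d)).injective he]
      · exact fun h => ⟨w, h, rfl⟩
    rw [h1, hr.mem_levelSubspace_iff hP hF, Submodule.mem_dualAnnihilator]
    have hval : ∀ x, dotProductEquiv ℝ (Fin d) w x = pairing w x := fun x =>
      dotProduct_comm w x
    constructor
    · intro h v hv
      have hle : Submodule.span ℝ (F -ᵥ F) ≤ LinearMap.ker (dotProductEquiv ℝ (Fin d) w) := by
        rw [Submodule.span_le]
        rintro _ ⟨x, hx, x', hx', rfl⟩
        change dotProductEquiv ℝ (Fin d) w (x - x') = 0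
        rw [map_sub, hval, hval]
        exact sub_eq_zero.2 (h x hx x' hx')
      exact hle hv
    · intro h x hx x' hx'
      have := h (x - x') (Submodule.subset_span ⟨x, hx, x', hx', rfl⟩)
      rw [map_sub, hval, hval] at this
      exact sub_eq_zero.1 this
  have h2 := Subspace.finrank_add_finrank_dualAnnihilator_eq (affineSpan ℝ F).direction
  rw [← hmap, LinearEquiv.finrank_map_eq, Module.finrank_fin_fun] at h2
  unfold dim
  omega

/-! ### Finiteness of the face set and faces of every dimension -/

theorem IsGeneralizedPermutahedron.finite_faces (hP : IsGeneralizedPermutahedron P) :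
    {F | IsFace P F}.Finite := by
  choose r hr using fun F : {F | IsFace P F} => hP.exists_isNormalPreorder F.2
  have hinj : Function.Injective r := by
    intro F G h
    obtain ⟨-, z, hz⟩ := isFace_iff.1 F.2
    have h1 := ((hr F).maxFace_eq_iff hP.1 F.2 z).1 hz.symm
    rw [h] at h1
    exact Subtype.ext (hz.trans (((hr G).maxFace_eq_iff hP.1 G.2 z).2 h1))
  exact Set.finite_coe_iff.1 (Finite.of_injective r hinj)

theorem IsFace.subset (hF : IsFace P F) : F ⊆ P := by
  obtain ⟨-, a, rfl⟩ := isFace_iff.1 hF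
  exact maxFace_subset _ _

theorem dim_mono {Q R : Set (Fin d → ℝ)} (h : Q ⊆ R) : dim Q ≤ dim R :=
  Submodule.finrank_mono (AffineSubspace.direction_le (affineSpan_mono ℝ h))

/-- A direction with distinct coordinates is compatible only with preorders whose classes are
singletons. -/
theorem IsGeneralizedPermutahedron.exists_vertex (hP : IsGeneralizedPermutahedron P) :
    ∃ F, IsFace P F ∧ dim F = 0 := by
  let y : Fin d → ℝ := fun i => ((i : ℕ) : ℝ)
  have hF := hP.1.isFace_maxFace y
  obtain ⟨r, hr⟩ := hP.exists_isNormalPreorder hF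
  refine ⟨_, hF, ?_⟩
  have h := hr.finrank_add_dim hP.1 hF
  have hy : Compat r y := (hr.2 y).1 subset_rfl
  have htop : levelSubspace r = ⊤ := by
    rw [eq_top_iff]
    intro w _ i j hij hji
    have h1 := le_antisymm (hy i j hij) (hy j i hji)
    have h2 : i = j := Fin.ext (Nat.cast_injective h1)
    rw [h2]
  rw [htop, finrank_top, Module.finrank_fin_fun] at h
  omega

theorem _root_.IsPre.exists_cover {r : Fin d → Fin d → Prop} (hr : IsPre r) {a b : Fin d} (hab : r a b)
    (hba : ¬ r b a) :
    ∃ b, r a b ∧ ¬ r b a ∧ ∀ i, r a i → r i b → r i a ∨ r b i := by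
  let p : Preorder (Fin d) := 
    { le := r, lt := fun i j => r i j ∧ ¬ r j i, le_refl := hr.refl, le_trans := hr.trans }
  have hw : @WellFoundedLT (Fin d) p.toLT := @Finite.to_wellFoundedLT (Fin d) _ p
  obtain ⟨b, hb1, hb2⟩ := @exists_covBy_of_wellFoundedLT (Fin d) p hw a
    (fun h => hba (h hab))
  have hlt : ∀ i j, p.lt i j ↔ r i j ∧ ¬ r j i := fun i j => p.lt_iff_le_not_ge i j
  refine ⟨b, ((hlt _ _).1 hb1).1, ((hlt _ _).1 hb1).2, fun i h1 h2 => ?_⟩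
  by_contra h
  push Not at h
  exact hb2 ((hlt _ _).2 ⟨h1, h.1⟩) ((hlt _ _).2 ⟨h2, h.2⟩)

/-- Merging a covering pair of classes cuts out a facet of the normal cone, whose interior
directions define a face one dimension larger. -/
theorem IsGeneralizedPermutahedron.exists_face_dim_succ (hP : IsGeneralizedPermutahedron P)
    (hF : IsFace P F) (hlt : dim F < dim P) : ∃ G, IsFace P G ∧ dim G = dim F + 1 := by
  obtain ⟨r, hr⟩ := hP.exists_isNormalPreorder hF
  have hdim := hr.finrank_add_dim hP.1 hF
  have hrel : ∃ a b, r a b ∧ ¬ r b a := by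
    -- If r were symmetric, z and -z would both lie in the normal cone of F = P_z, so z would be
    -- constant on P and F would be all of P.
    by_contra hsymm
    push Not at hsymm
    obtain ⟨-, z, rfl⟩ := isFace_iff.1 hF
    have hz : Compat r z := (hr.2 z).1 subset_rfl
    have hnz : Compat r (-z) := fun i j hij => neg_le_neg (hz j i (hsymm i j hij))
    have hsub := (hr.2 _).2 hnz
    obtain ⟨x₀, hx₀⟩ := hP.1.maxFace_nonempty z
    have hPz : P ⊆ maxFace P z := fun x hx => by
      have := (hsub hx₀).2 x hx
      rw [pairing_neg, pairing_neg] at this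
      exact mem_maxFace_of_le hx₀ hx (neg_le_neg_iff.1 this)
    exact absurd hlt (not_lt.2 (dim_mono hPz))
  obtain ⟨a, b', hab', hba'⟩ := hrel
  obtain ⟨b, hab, hba, hcov⟩ := hr.1.exists_cover hab' hba'
  have hr' : IsPre (insertRel r b a) := hr.1.insertRel b a
  obtain ⟨y, hy⟩ := hr'.exists_strictCompat
  have hcompat : ∀ w : Fin d → ℝ, Compat (insertRel r b a) w ↔ Compat r w ∧ w b ≤ w a := fun w =>
    compat_insertRel hr.1
  have hyc := (hcompat y).1 hy.compat
  have hFG : F ⊆ maxFace P y := (hr.2 y).2 hyc.1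
  have hG := hP.1.isFace_maxFace y
  have hnorm : IsNormalPreorder P (maxFace P y) (insertRel r b a) := by
    refine ⟨hr', fun w => ⟨fun hw => (hcompat w).2 ⟨(hr.2 w).1 (hFG.trans hw), ?_⟩, fun hw => ?_⟩⟩
    · obtain ⟨K, -, hKe⟩ := hP.1.subset_maxFace_of_const (w := -w) (z := y) fun x hx x' hx' => by
        rw [pairing_neg, pairing_neg, pairing_eq_of_mem_maxFace (hw hx) (hw hx')]
      have h1 := (hr.2 _).1 (hFG.trans hKe.ge) a b hab
      have h2 : y a = y b := le_antisymm (hyc.1 a b hab) hyc.2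
      simp only [Pi.add_apply, Pi.neg_apply, Pi.smul_apply, smul_eq_mul, h2] at h1
      linarith
    · obtain ⟨K, hK⟩ := hy.exists_compat_add_smul (neg_mem (mem_levelSubspace_of_compat hw))
      obtain ⟨x₀, hx₀⟩ := hF.1
      intro x hx
      exact mem_maxFace_of_mem_add_smul ((hr.2 _).2 ((hcompat _).1 hK).1 hx₀)
        ((hr.2 _).2 ((hcompat _).1 hw).1 hx₀) (hFG hx₀) hx
  have hdim' := hnorm.finrank_add_dim hP.1 hG
  have hc := finrank_levelSubspace_insertRel_of_cover hr.1 hab hba hcov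
  exact ⟨_, hG, by omega⟩

theorem IsGeneralizedPermutahedron.exists_face_dim_eq (hP : IsGeneralizedPermutahedron P) {k : ℕ}
    (hk : k ≤ dim P) : ∃ F, IsFace P F ∧ dim F = k := by
  induction k with
  | zero => exact hP.exists_vertex
  | succ k ih =>
    obtain ⟨F, hF, hFk⟩ := ih (Nat.le_of_succ_le hk)
    obtain ⟨G, hG, hGk⟩ := hP.exists_face_dim_succ hF (by omega)
    exact ⟨G, hG, by omega⟩

/-! ### Reciprocity for one face and summation over the k-faces -/

theorem IsGeneralizedPermutahedron.exists_face_polynomial (hP : IsGeneralizedPermutahedron P)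
    (hF : IsFace P F) : ∃ p : ℚ[X],
    (∀ m : ℕ, 0 < m →
      p.eval (m : ℚ) = ∑ y ∈ box d m, open Classical in if maxFace P (toDir y) = F then 1 else 0) ∧
    (∀ m : ℕ, 0 < m → (-1 : ℚ) ^ (d - dim F) * p.eval (-(m : ℚ)) =
      ∑ y ∈ box d m, open Classical in if F ⊆ maxFace P (toDir y) then 1 else 0) ∧
    p.natDegree ≤ d - dim F ∧ 0 < p.coeff (d - dim F) := by
  classical
  obtain ⟨r, hr⟩ := hP.exists_isNormalPreorder hF
  obtain ⟨p, h1, h2, h3, h4⟩ := exists_orderPolynomial hr.1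
  have hdim := hr.finrank_add_dim hP.1 hF
  have hc : Module.finrank ℝ (levelSubspace r) = d - dim F := by omega
  rw [hc] at h2 h3 h4
  refine ⟨p, fun m hm => ?_, fun m hm => ?_, h3, h4⟩
  · rw [h1 m hm, Finset.sum_boole]
    congr 2
    ext y
    simp only [strictMaps, box, Finset.mem_filter]
    refine and_congr (by simp) ?_
    rw [hr.maxFace_eq_iff hP.1 hF]
    simp [StrictCompat, toDir]
  · rw [h2 m hm, Finset.sum_boole]
    congr 2
    ext y
    simp only [weakMaps, box, Finset.mem_filter]
    refine and_congr (by simp) ?_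
    rw [hr.2]
    simp [Compat, toDir]

end GenPerm

theorem mainTheorem1 {d k : ℕ} (hk : k < d) (P : Set (Fin d → ℝ))
    (hP : GenPerm.IsGeneralizedPermutahedron P) :
    ∃ p : Polynomial ℚ,
      (∀ m : ℕ, 0 < m → p.eval (m : ℚ) = (GenPerm.chi k P m : ℚ)) ∧
      (k ≤ GenPerm.dim P → p.degree = ((d - k : ℕ) : WithBot ℕ)) ∧
      (GenPerm.dim P < k → p = 0) ∧
      (∀ m : ℕ, 0 < m →
        (-1 : ℚ) ^ (d - k) * p.eval (-(m : ℚ)) =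
          ∑ y ∈ GenPerm.box d m,
            (GenPerm.numFaces k (GenPerm.maxFace P (GenPerm.toDir y)) : ℚ)) := by
  classical
  have hfin : {F | GenPerm.IsFace P F ∧ GenPerm.dim F = k}.Finite :=
    hP.finite_faces.subset fun F hF => hF.1
  let T := hfin.toFinset
  have hT : ∀ F, F ∈ T ↔ GenPerm.IsFace P F ∧ GenPerm.dim F = k := fun F => by simp [T]
  have hpoly := fun F : T => hP.exists_face_polynomial ((hT F).1 F.2).1
  choose q hq1 hq2 hq3 hq4 using hpoly
  have hTd : ∀ F : T, GenPerm.dim F.1 = k := fun F => ((hT F).1 F.2).2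
  simp only [hTd] at hq2 hq3 hq4
  refine ⟨∑ F, q F, fun m hm => ?_, fun hkP => ?_, fun hkP => ?_, fun m hm => ?_⟩
  · rw [Polynomial.eval_finsetSum, Finset.sum_congr rfl fun F _ => hq1 F m hm, Finset.sum_comm,
      GenPerm.chi, ← Finset.sum_boole]
    refine Finset.sum_congr rfl fun y _ => ?_
    rw [Finset.sum_coe_sort T fun F =>
      if GenPerm.maxFace P (GenPerm.toDir y) = F then (1 : ℚ) else 0, Finset.sum_ite_eq]
    simp [hT, hP.1.isFace_maxFace]
  · obtain ⟨F, hF⟩ := hP.exists_face_dim_eq hkP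
    have hcoeff : 0 < (∑ F, q F).coeff (d - k) := by
      rw [Polynomial.finsetSum_coeff]
      exact Finset.sum_pos (fun F _ => hq4 F) ⟨⟨F, (hT F).2 hF⟩, Finset.mem_univ _⟩
    refine le_antisymm ?_ (Polynomial.le_degree_of_ne_zero hcoeff.ne')
    exact Polynomial.degree_le_of_natDegree_le
      (Polynomial.natDegree_sum_le_of_forall_le _ _ fun F _ => hq3 F)
  · have : IsEmpty T := ⟨fun F => by
      have h1 := ((hT F).1 F.2)
      have h2 := GenPerm.dim_mono h1.1.subset
      omega⟩
    simp
  -- Double count of the pairs (y, F) with F a k-face of P contained in P_y.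
  · rw [Polynomial.eval_finsetSum, Finset.mul_sum, Finset.sum_congr rfl fun F _ => hq2 F m hm,
      Finset.sum_comm]
    refine Finset.sum_congr rfl fun y _ => ?_
    rw [Finset.sum_coe_sort T fun F =>
      if F ⊆ GenPerm.maxFace P (GenPerm.toDir y) then (1 : ℚ) else 0, Finset.sum_boole,
      GenPerm.numFaces, ← Set.ncard_coe_finset]
    congr 2
    ext F
    simp only [Finset.coe_filter, hT, Set.mem_ofPred_eq, hP.1.isFace_maxFace_iff]
    tauto
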